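/- Definitions. A \emph{bounded hoop} is an algebra $\langle A,\cdot,\to,0,1\rangle$ such that $\langle A,\cdot,1\rangle$ is a commutative monoid, $x\to x=1$, $x\cdot(x\to y)=y\cdot(y\to x)$, $(x\cdot y)\to z=x\to(y\to z)$ and $0\to x=1$. A \emph{BL-algebra} is an algebra $\langle A,\vee,\wedge,\cdot,\to,0,1\rangle$ such that $\langle A,\vee,\wedge,0,1\rangle$ is a lattice with least element $0$ and greatest element $1$, $\langle A,\cdot,1\rangle$ is a commutative monoid, $x\cdot y\le z$ if and only if $x\le y\to z$, $(x\to y)\vee(y\to x)=1$, and $x\cdot(x\to y)=y\cdot(y\to x)$. Write $\neg x=x\to 0$, and let $\mathbf 2$ be the two-element bounded hoop (respectively BL-algebra) on $\{0,1\}$. A variety $\mathsf V$ is \emph{locally finite} if its finitely generated members are finite. An algebra is \emph{subdirectly irreducible} if it has at least two elements and the intersection of all its congruences other than equality is not equality. An algebra $A\in\mathsf V$ is \emph{finitely presented} in $\mathsf V$ if it is isomorphic to $F_{\mathsf V}(X)/\theta$ with $X$ a finite set, $F_{\mathsf V}(X)$ the free algebra of $\mathsf V$ over $X$ and $\theta$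 a finitely generated congruence. An algebra $A\in\mathsf V$ is \emph{projective} in $\mathsf V$ if for all $B,C\in\mathsf V$, every homomorphism $h:A\to C$ and every surjective homomorphism $g:B\to C$ there is a homomorphism $f:A\to B$ with $gf=h$. Theorem. Let $\mathsf V$ be a locally finite variety of bounded hoops, or a locally finite variety of BL-algebras, such that every finite subdirectly irreducible algebra in $\mathsf V$ has $\mathbf 2$ as a homomorphic image. Then every finitely presented algebra in $\mathsf V$ with at least two elements is projective in $\mathsf V$. In particular: (a) The Boolean algebras, regarded as algebras $\langle A,\vee,\wedge,\cdot,\to,0,1\rangle$ with $x\cdot y=x\wedge y$ and $x\to y=\neg x\vee y$, form a locally finite variety of BL-algebras in which every finite subdirectly irreducible algebra has $\mathbf 2$ as a homomorphic image; hence every finitely presented Boolean algebra with at least two elements is projective in the variety of Boolean algebras. (b) If $\mathsf V$ is a locally finite variety of BL-algebras satisfying the identity $\neg x\vee\neg\neg x\approx 1$ (a Stonean variety), then every finite subdirectly irreducible algebra in $\mathsf V$ has $\mathbf 2$ as a homomorphic image; hence every finitely presented algebra in $\mathsf V$ with at least two elements is projective in $\mathsf V$. -/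

import Mathlib

open scoped FirstOrder
open FirstOrder.Language

/-! ## Universal algebra

A similarity type is a first-order language without relation symbols; an algebra of that type is
an `L.Structure`, homomorphisms are `A →[L] B` and isomorphisms are `A ≃[L] B`. -/

/-- A congruence of an algebra: an equivalence relation compatible with all basic operations. -/
structure AlgCongruence (L : FirstOrder.Language.{0, 0}) (A : Type*) [L.Structure A] extends Setoid A where
  compat : ∀ {n : ℕ} (f : L.Functions n) (x y : Fin n → A),
    (∀ i, r (x i) (y i)) → r (Structure.funMap f x) (Structure.funMap f y)

namespace AlgCongruence

variable {L : FirstOrder.Language.{0, 0}} {A : Type*} [L.Structure A]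

/-- The congruence generated by a set of pairs, that is, the least congruence containing it. -/
def gen (L : FirstOrder.Language.{0, 0}) {A : Type*} [L.Structure A] (S : Set (A × A)) :
    AlgCongruence L A where
  r a b := ∀ θ : AlgCongruence L A, (∀ p ∈ S, θ.r p.1 p.2) → θ.r a b
  iseqv :=
    { refl := fun a θ _ => θ.iseqv.refl a
      symm := fun h θ hθ => θ.iseqv.symm (h θ hθ)
      trans := fun h k θ hθ => θ.iseqv.trans (h θ hθ) (k θ hθ) }
  compat f x y h θ hθ := θ.compat f x y fun i => h i θ hθ

/-- A congruence is finitely generated (equivalently, a compact element of the congruence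
lattice) if it is generated by a finite set of pairs. -/
def IsFG (θ : AlgCongruence L A) : Prop :=
  ∃ S : Finset (A × A), ∀ a b : A, θ.r a b ↔ (gen L (S : Set (A × A))).r a b

/-- The underlying set of the quotient algebra `A / θ`. -/
def QuotientAlg (θ : AlgCongruence L A) : Type _ := Quotient θ.toSetoid

/-- The quotient algebra `A / θ`, with the operations induced on congruence classes. -/
instance instStructureQuotientAlg [L.IsAlgebraic] (θ : AlgCongruence L A) : L.Structure θ.QuotientAlg :=
  @quotientStructure L A θ.toSetoid
    { toStructure := inferInstance
      fun_equiv := fun x y h => θ.compat _ x y h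
      rel_equiv := fun {_} {r} _ _ _ => isEmptyElim r }

end AlgCongruence

/-- The algebra of terms over a set `X` of variables (the absolutely free algebra). -/
instance termAlgebra (L : FirstOrder.Language.{0, 0}) [L.IsAlgebraic] (X : Type*) :
    L.Structure (L.Term X) where
  funMap f ts := Term.func f ts
  RelMap r _ := isEmptyElim r

/-- A variety of algebras of type `L`, presented by a set of identities `s ≈ t` in the variables
`x₀, x₁, …`. -/
structure AlgVariety (L : FirstOrder.Language.{0, 0}) where
  identities : Set (L.Term ℕ × L.Term ℕ)

namespace AlgVariety

variable {L : FirstOrder.Language.{0, 0}}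

/-- `A` belongs to the variety: it satisfies all the defining identities. -/
def Mem (V : AlgVariety L) (A : Type*) [L.Structure A] : Prop :=
  ∀ e ∈ V.identities, ∀ v : ℕ → A, e.1.realize v = e.2.realize v

/-- A variety is locally finite if all its finitely generated members are finite. -/
def LocallyFinite.{u} (V : AlgVariety L) : Prop :=
  ∀ (A : Type u) [L.Structure A], V.Mem A → Structure.FG L A → Finite A

/-- `A` is projective in the variety `V`. -/
def IsProjective.{u} (V : AlgVariety L) (A : Type u) [L.Structure A] : Prop :=
  V.Mem A ∧
    ∀ (B C : Type u) [L.Structure B] [L.Structure C], V.Mem B → V.Mem C →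
      ∀ (h : A →[L] C) (g : B →[L] C), Function.Surjective g → ∃ f : A →[L] B, g.comp f = h

variable [L.IsAlgebraic]

/-- The congruence of the term algebra over `X` generated by all substitution instances of the
identities of `V`. -/
def freeCongruence (V : AlgVariety L) (X : Type*) : AlgCongruence L (L.Term X) :=
  AlgCongruence.gen L
    {p | ∃ e ∈ V.identities, ∃ σ : ℕ → L.Term X, p = (e.1.subst σ, e.2.subst σ)}

/-- The free algebra of `V` over `X`. -/
abbrev Free (V : AlgVariety L) (X : Type*) : Type _ := (V.freeCongruence X).QuotientAlg

/-- `A` is finitely presented in `V`: it is isomorphic to the quotient of a free algebra of `V`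
over a finite set by a finitely generated congruence. -/
def IsFinitelyPresented (V : AlgVariety L) (A : Type*) [L.Structure A] : Prop :=
  V.Mem A ∧ ∃ (n : ℕ) (θ : AlgCongruence L (V.Free (Fin n))), θ.IsFG ∧ Nonempty (θ.QuotientAlg ≃[L] A)

end AlgVariety

/-- `A` is subdirectly irreducible: it has at least two elements, and the intersection of all its
congruences other than equality is again different from equality. -/
def SubdirectlyIrreducible (L : FirstOrder.Language.{0, 0}) (A : Type*) [L.Structure A] : Prop :=
  ∃ a b : A, a ≠ b ∧ ∀ θ : AlgCongruence L A, (∃ c d : A, c ≠ d ∧ θ.r c d) → θ.r a b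

/-- Every finite subdirectly irreducible member of `V` has the algebra `T` as a homomorphic
image. -/
def FiniteSIMapOnto.{u} {L : FirstOrder.Language.{0, 0}} (V : AlgVariety L) (T : Type) [L.Structure T] :
    Prop :=
  ∀ (A : Type u) [L.Structure A], V.Mem A → Finite A → SubdirectlyIrreducible L A →
    ∃ f : A →[L] T, Function.Surjective f

/-- Every finitely presented member of `V` with at least two elements is projective in `V`. -/
def FinitelyPresentedProjective.{u} {L : FirstOrder.Language.{0, 0}} [L.IsAlgebraic] (V : AlgVariety L) :
    Prop :=
  ∀ (A : Type u) [L.Structure A], V.IsFinitelyPresented A → Nontrivial A → V.IsProjective A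

/-! ## Bounded hoops -/

/-- The operation symbols `·, →, 0, 1` of bounded hoops. -/
inductive HoopFunc : ℕ → Type
  | mul : HoopFunc 2
  | imp : HoopFunc 2
  | zero : HoopFunc 0
  | one : HoopFunc 0

/-- The language of bounded hoops. -/
def hoopLang : FirstOrder.Language.{0, 0} where
  Functions := HoopFunc
  Relations := fun _ => Empty

instance : hoopLang.IsAlgebraic := fun _ => inferInstanceAs (IsEmpty Empty)

namespace Hoop

variable {A : Type*} [hoopLang.Structure A]

def mul (a b : A) : A := Structure.funMap (L := hoopLang) HoopFunc.mul ![a, b]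
def imp (a b : A) : A := Structure.funMap (L := hoopLang) HoopFunc.imp ![a, b]
def zero (A : Type*) [hoopLang.Structure A] : A :=
  Structure.funMap (L := hoopLang) HoopFunc.zero ![]
def one (A : Type*) [hoopLang.Structure A] : A :=
  Structure.funMap (L := hoopLang) HoopFunc.one ![]

end Hoop

open Hoop in
/-- `A` is a bounded hoop: a commutative monoid with `x → x = 1`, `x(x → y) = y(y → x)` and
`xy → z = x → (y → z)`, in which `0` is the least element for the order
`x ≤ y` iff `x → y = 1`. -/
structure IsBoundedHoop (A : Type*) [hoopLang.Structure A] : Prop where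
  mul_assoc : ∀ a b c : A, mul (mul a b) c = mul a (mul b c)
  mul_comm : ∀ a b : A, mul a b = mul b a
  one_mul : ∀ a : A, mul (one A) a = a
  imp_self : ∀ a : A, imp a a = one A
  div : ∀ a b : A, mul a (imp a b) = mul b (imp b a)
  mul_imp : ∀ a b c : A, imp (mul a b) c = imp a (imp b c)
  zero_le : ∀ a : A, imp (zero A) a = one A

/-- The two-element bounded hoop `𝟐`. -/
instance hoopTwo : hoopLang.Structure Bool where
  funMap
    | HoopFunc.mul, v => v 0 && v 1
    | HoopFunc.imp, v => !(v 0) || v 1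
    | HoopFunc.zero, _ => false
    | HoopFunc.one, _ => true
  RelMap r _ := Empty.elim r

/-! ## BL-algebras -/

/-- The operation symbols `∨, ∧, ·, →, 0, 1` of BL-algebras. -/
inductive BLFunc : ℕ → Type
  | sup : BLFunc 2
  | inf : BLFunc 2
  | mul : BLFunc 2
  | imp : BLFunc 2
  | zero : BLFunc 0
  | one : BLFunc 0

/-- The language of BL-algebras (and of all bounded commutative integral residuated lattices). -/
def blLang : FirstOrder.Language.{0, 0} where
  Functions := BLFunc
  Relations := fun _ => Empty

instance : blLang.IsAlgebraic := fun _ => inferInstanceAs (IsEmpty Empty)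

namespace BL

variable {A : Type*} [blLang.Structure A]

def sup (a b : A) : A := Structure.funMap (L := blLang) BLFunc.sup ![a, b]
def inf (a b : A) : A := Structure.funMap (L := blLang) BLFunc.inf ![a, b]
def mul (a b : A) : A := Structure.funMap (L := blLang) BLFunc.mul ![a, b]
def imp (a b : A) : A := Structure.funMap (L := blLang) BLFunc.imp ![a, b]
def zero (A : Type*) [blLang.Structure A] : A := Structure.funMap (L := blLang) BLFunc.zero ![]
def one (A : Type*) [blLang.Structure A] : A := Structure.funMap (L := blLang) BLFunc.one ![]

/-- The lattice order. -/
def le (a b : A) : Prop := inf a b = a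

/-- The negation `¬a = a → 0`. -/
def neg (a : A) : A := imp a (zero A)

end BL

open BL in
/-- `A` is a BL-algebra: a bounded commutative integral residuated lattice satisfying
prelinearity and divisibility. -/
structure IsBLAlgebra (A : Type*) [blLang.Structure A] : Prop where
  sup_comm : ∀ a b : A, sup a b = sup b a
  sup_assoc : ∀ a b c : A, sup (sup a b) c = sup a (sup b c)
  inf_comm : ∀ a b : A, inf a b = inf b a
  inf_assoc : ∀ a b c : A, inf (inf a b) c = inf a (inf b c)
  sup_inf_self : ∀ a b : A, sup a (inf a b) = a
  inf_sup_self : ∀ a b : A, inf a (sup a b) = a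
  zero_le : ∀ a : A, le (zero A) a
  le_one : ∀ a : A, le a (one A)
  mul_assoc : ∀ a b c : A, mul (mul a b) c = mul a (mul b c)
  mul_comm : ∀ a b : A, mul a b = mul b a
  one_mul : ∀ a : A, mul (one A) a = a
  residuation : ∀ a b c : A, le (mul a b) c ↔ le a (imp b c)
  prel : ∀ a b : A, sup (imp a b) (imp b a) = one A
  div : ∀ a b : A, mul a (imp a b) = mul b (imp b a)

open BL in
/-- `A` is a Stonean BL-algebra: it satisfies `¬x ∨ ¬¬x ≈ 1`. -/
structure IsStoneanBL (A : Type*) [blLang.Structure A] : Prop extends IsBLAlgebra A where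
  stone : ∀ a : A, sup (neg a) (neg (neg a)) = one A

open BL in
/-- `A` is a Boolean algebra in the language of BL-algebras: the lattice reduct is a Boolean
algebra with bounds `0, 1`, the product is the meet, and `x → y = ¬x ∨ y`. -/
structure IsBooleanBL (A : Type*) [blLang.Structure A] : Prop where
  sup_comm : ∀ a b : A, sup a b = sup b a
  sup_assoc : ∀ a b c : A, sup (sup a b) c = sup a (sup b c)
  inf_comm : ∀ a b : A, inf a b = inf b a
  inf_assoc : ∀ a b c : A, inf (inf a b) c = inf a (inf b c)
  sup_inf_self : ∀ a b : A, sup a (inf a b) = a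
  inf_sup_self : ∀ a b : A, inf a (sup a b) = a
  inf_sup_distrib : ∀ a b c : A, inf a (sup b c) = sup (inf a b) (inf a c)
  zero_le : ∀ a : A, le (zero A) a
  le_one : ∀ a : A, le a (one A)
  inf_neg : ∀ a : A, inf a (neg a) = zero A
  sup_neg : ∀ a : A, sup a (neg a) = one A
  mul_eq_inf : ∀ a b : A, mul a b = inf a b
  imp_eq : ∀ a b : A, imp a b = sup (neg a) b

/-- The two-element BL-algebra `𝟐`. -/
instance blTwo : blLang.Structure Bool where
  funMap
    | BLFunc.sup, v => v 0 || v 1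
    | BLFunc.inf, v => v 0 && v 1
    | BLFunc.mul, v => v 0 && v 1
    | BLFunc.imp, v => !(v 0) || v 1
    | BLFunc.zero, _ => false
    | BLFunc.one, _ => true
  RelMap r _ := Empty.elim r

universe u

/-! ## Bounded hoops, in operational notation -/

/-! Let `A` be a nontrivial finitely presented algebra. It is a quotient `g : F → A` of a free
algebra on finitely many generators, and `F` is finite by local finiteness. A retract of a free
algebra is projective, so it suffices to find a section of `g`
(`finitelyPresentedProjective_of_section`).

Since `F` is finite, the filter `g⁻¹(1)` has a least element `e`. It is idempotent, and the kernel
of `g` is the relation `e ⇨ x = e ⇨ y`. The finite nontrivial algebra `A` has a subdirectly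
irreducible quotient, hence a homomorphism `v` to the two-element algebra. The map `x ↦ (e ⇨ x) ·
(¬e ⇨ v (g x))` depends only on `g x`, lies over `g x`, and is an endomorphism of `F`
(`retract_isHom`). It therefore factors through `g` as a section (`exists_section`). The hard
ingredient is `idem_imp_mul`: for idempotent `e`, the map `x ↦ e ⇨ x` preserves products.

BL-algebras reduce to hoops because their meet and join are terms in product and implication. In the
Stonean case negations are idempotent and subdirect irreducibility forces `¬x = 1` or `¬¬x = 1`, so
"being nonzero" is a homomorphism to the two-element algebra. Boolean algebras are Stonean, and are
locally finite because their two-valued homomorphisms separate points. -/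

/-- Bounded hoops, with the implication written `⇨`. -/
class BddHoop (A : Type*) extends CommMonoid A, HImp A, Bot A where
  himp_self' : ∀ a : A, a ⇨ a = 1
  div' : ∀ a b : A, a * (a ⇨ b) = b * (b ⇨ a)
  mul_himp' : ∀ a b c : A, (a * b) ⇨ c = a ⇨ (b ⇨ c)
  bot_himp' : ∀ a : A, ⊥ ⇨ a = 1

namespace BddHoop

variable {A : Type*} [BddHoop A]

/-- Divisibility already acts as antisymmetry: two elements whose implications both ways equal `1`
coincide. -/
theorem one_imp (a : A) : (1 : A) ⇨ a = a := by
  have h1 : a * (a ⇨ 1) = 1 ⇨ a := by rw [div' a 1, _root_.one_mul]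
  have h2 : (1 ⇨ a) ⇨ a = 1 := by
    have := mul_himp' (1 : A) (1 ⇨ a) a
    rw [_root_.one_mul] at this
    have h3 := mul_himp' (1 ⇨ a) (1 : A) a
    rw [_root_.mul_one, himp_self'] at h3
    exact h3
  have h4 : a ⇨ (1 ⇨ a) = 1 := by
    rw [← mul_himp', _root_.mul_one, himp_self']
  have := div' a (1 ⇨ a)
  rw [h4, h2, _root_.mul_one, _root_.mul_one] at this
  exact this.symm

theorem imp_one (a : A) : a ⇨ (1 : A) = 1 := by
  have h1 : a * (a ⇨ 1) = a := by rw [div' a 1, _root_.one_mul, one_imp]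
  have : (a * (a ⇨ 1)) ⇨ 1 = 1 := by
    rw [_root_.mul_comm, mul_himp', himp_self']
  rwa [h1] at this

instance : PartialOrder A where
  le a b := a ⇨ b = 1
  le_refl := himp_self'
  le_trans a b c hab hbc := by
    -- Below `b` means being a multiple of `b`, by divisibility.
    have h1 : a = b * (b ⇨ a) := by rw [← div', hab, _root_.mul_one]
    show a ⇨ c = 1
    rw [h1, _root_.mul_comm, mul_himp', hbc, imp_one]
  le_antisymm a b hab hba := by
    have := div' a b
    rwa [hab, hba, _root_.mul_one, _root_.mul_one] at this

theorem le_def {a b : A} : a ≤ b ↔ a ⇨ b = 1 := Iff.rfl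

theorem mul_le_iff {a b c : A} : a * b ≤ c ↔ a ≤ b ⇨ c := by
  rw [le_def, le_def, mul_himp']

theorem le_top' (a : A) : a ≤ 1 := imp_one a

theorem bot_le' (a : A) : ⊥ ≤ a := bot_himp' a

theorem mul_le_mul_of_le {a b c d : A} (h : a ≤ b) (k : c ≤ d) : a * c ≤ b * d := by
  rw [mul_le_iff]
  refine h.trans ?_
  rw [← mul_le_iff, _root_.mul_comm, mul_le_iff]
  refine k.trans ?_
  rw [← mul_le_iff, _root_.mul_comm]

theorem mul_le_left' (a b : A) : a * b ≤ a := by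
  simpa using mul_le_mul_of_le (le_refl a) (le_top' b)

theorem mul_le_right' (a b : A) : a * b ≤ b := by
  simpa using mul_le_mul_of_le (le_top' a) (le_refl b)

theorem mul_imp_le (a b : A) : a * (a ⇨ b) ≤ b := by
  rw [_root_.mul_comm, mul_le_iff]

theorem mul_imp_of_le {a b : A} (h : b ≤ a) : a * (a ⇨ b) = b := by
  rw [div', le_def.1 h, _root_.mul_one]

theorem imp_mono_right (a : A) {b c : A} (h : b ≤ c) : a ⇨ b ≤ a ⇨ c := by
  rw [← mul_le_iff, _root_.mul_comm]
  exact (mul_imp_le a b).trans h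

theorem imp_anti_left {a b : A} (h : a ≤ b) (c : A) : b ⇨ c ≤ a ⇨ c := by
  rw [← mul_le_iff]
  refine (mul_le_mul_of_le le_rfl h).trans ?_
  rw [_root_.mul_comm]
  exact mul_imp_le b c

theorem le_imp (a b : A) : b ≤ a ⇨ b := by
  rw [← mul_le_iff]
  exact mul_le_left' b a

theorem imp_comm (a b c : A) : a ⇨ (b ⇨ c) = b ⇨ (a ⇨ c) := by
  rw [← mul_himp', _root_.mul_comm, mul_himp']

/-- Together with `mul_le_left'` and `mul_imp_le`, this makes `a * (a ⇨ b)` the meet of `a` and `b`.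
-/
theorem le_div {a b c : A} (h : c ≤ a) (k : c ≤ b) : c ≤ a * (a ⇨ b) := by
  calc c = a * (a ⇨ c) := (mul_imp_of_le h).symm
    _ ≤ _ := mul_le_mul_of_le le_rfl (imp_mono_right a k)

/-- Implications preserve binary meets. -/
theorem imp_div (a b c : A) :
    a ⇨ (b * (b ⇨ c)) = (a ⇨ b) * ((a ⇨ b) ⇨ (a ⇨ c)) := by
  apply le_antisymm
  · apply le_div
    · exact imp_mono_right a (mul_le_left' _ _)
    · exact imp_mono_right a (mul_imp_le _ _)
  · rw [← mul_le_iff]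
    apply le_div
    · rw [mul_le_iff]
      exact mul_le_left' _ _
    · rw [mul_le_iff]
      exact mul_imp_le _ _

/-! ### Idempotent elements of a bounded hoop -/

section Idempotent

variable {e : A} (he : e * e = e)
include he

theorem idem_mul_of_le {x : A} (h : x ≤ e) : e * x = x := by
  rw [← mul_imp_of_le h, ← _root_.mul_assoc, he]

theorem idem_mul_of_ge {x : A} (h : e ≤ x) : e * x = e := by
  apply le_antisymm (mul_le_left' _ _)
  calc e = e * e := he.symm
    _ ≤ e * x := mul_le_mul_of_le le_rfl h

/-- The left side is a meet, so multiplying by an idempotent is taking the meet with it. -/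
theorem idem_mul_imp (x : A) : e * (e ⇨ x) = e * x := by
  apply le_antisymm
  · rw [← idem_mul_of_le he (mul_le_left' e (e ⇨ x))]
    exact mul_le_mul_of_le le_rfl (mul_imp_le _ _)
  · exact mul_le_mul_of_le le_rfl (le_imp _ _)

theorem idem_imp_imp (x y : A) : e ⇨ (x ⇨ y) = (e ⇨ x) ⇨ (e ⇨ y) := by
  rw [imp_comm (e ⇨ x), ← mul_himp', ← mul_himp', idem_mul_imp he]

theorem idem_imp_idem (x : A) : e ⇨ (e ⇨ x) = e ⇨ x := by
  rw [← mul_himp', he]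

/-- The defect `r = u ⇨ p * q` between `p * q` and its closure `u` must be `1`. It satisfies `e ≤
r`, so `r ⇨ u = u`; divisibility then yields `u * (u ⇨ r) = p * q`, whence `u ⇨ r ≤ r`. As `p` and
`q` lie above `u`, implication from either fixes `r`, and so does implication from `p * q`. But `p *
q ≤ r`. -/
theorem idem_imp_mul_of_fixed {p q : A} (hp : e ⇨ p = p) (hq : e ⇨ q = q) :
    e ⇨ (p * q) = p * q := by
  set u := e ⇨ (p * q) with hu
  set r := u ⇨ (p * q) with hr
  have hup : u ≤ p := by
    rw [← hp]
    exact imp_mono_right e (mul_le_left' _ _)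
  have huq : u ≤ q := by
    rw [← hq]
    exact imp_mono_right e (mul_le_right' _ _)
  have hpqu : p * q ≤ u := le_imp _ _
  have her : e ≤ r := by
    rw [hr, ← mul_le_iff]
    exact mul_imp_le _ _
  have hru : r ⇨ u = u := by
    rw [hu, ← mul_himp', _root_.mul_comm, idem_mul_of_ge he her]
  have h1 : u * (u ⇨ r) = p * q := by
    rw [div', hru, _root_.mul_comm, hr, mul_imp_of_le hpqu]
  have h2 : u ⇨ r ≤ r := by
    conv_rhs => rw [hr]
    rw [← mul_le_iff, _root_.mul_comm, h1]
  have hpr : p ⇨ r = r := le_antisymm ((imp_anti_left hup r).trans h2) (le_imp _ _)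
  have hqr : q ⇨ r = r := le_antisymm ((imp_anti_left huq r).trans h2) (le_imp _ _)
  have h3 : (p * q) ⇨ r = r := by rw [mul_himp', hqr, hpr]
  have h4 : r = 1 := by
    rw [← h3]
    exact le_imp u (p * q)
  exact le_antisymm h4 hpqu

/-- For an idempotent `e`, the map `x ↦ e → x` preserves products. -/
theorem idem_imp_mul (x y : A) : e ⇨ (x * y) = (e ⇨ x) * (e ⇨ y) := by
  rw [← idem_imp_mul_of_fixed he (idem_imp_idem he x) (idem_imp_idem he y)]
  apply le_antisymm
  · exact imp_mono_right e (mul_le_mul_of_le (le_imp _ _) (le_imp _ _))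
  · rw [← mul_le_iff, _root_.mul_comm, idem_mul_imp he]
    calc e * ((e ⇨ x) * (e ⇨ y)) = (e * (e ⇨ x)) * (e * (e ⇨ y)) := by
          rw [mul_mul_mul_comm, he]
      _ ≤ x * y := mul_le_mul_of_le (mul_imp_le _ _) (mul_imp_le _ _)

/-- `idem_imp_mul` applied to `⊥ * ⊥ = ⊥`. -/
theorem neg_idem : (e ⇨ ⊥) * (e ⇨ ⊥) = e ⇨ (⊥ : A) := by
  rw [← idem_imp_mul he]
  congr 1
  exact le_antisymm (mul_le_left' _ _) (bot_le' _)

end Idempotent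

/-! ### Two-valued homomorphisms and sections -/

/-- A map preserving product, implication and the least element. -/
structure IsHom {A B : Type*} [BddHoop A] [BddHoop B] (f : A → B) : Prop where
  map_mul : ∀ x y, f (x * y) = f x * f y
  map_himp : ∀ x y, f (x ⇨ y) = f x ⇨ f y
  map_bot : f ⊥ = ⊥

theorem IsHom.map_one {A B : Type*} [BddHoop A] [BddHoop B] {f : A → B} (hf : IsHom f) :
    f 1 = 1 := by
  rw [← himp_self' (1 : A), hf.map_himp, himp_self']

/-- A homomorphism into the two-element bounded hoop. -/
structure IsBoolHom (v : A → Bool) : Prop where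
  map_mul : ∀ x y, v (x * y) = (v x && v y)
  map_himp : ∀ x y, v (x ⇨ y) = (!v x || v y)
  map_bot : v ⊥ = false

/-- The endomorphism `x ↦ (e → x) · (¬e → v x)` attached to an element `e` and a two-valued
homomorphism `v`. -/
def retract (e : A) (v : A → Bool) (x : A) : A :=
  (e ⇨ x) * bif v x then 1 else (e ⇨ ⊥) ⇨ ⊥

theorem retract_isHom {e : A} (he : e * e = e) {v : A → Bool} (hv : IsBoolHom v) :
    IsHom (retract e v) := by
  have hm : (e ⇨ ⊥) * (e ⇨ ⊥) = e ⇨ (⊥ : A) := neg_idem he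
  have hn : ((e ⇨ ⊥) ⇨ ⊥) * ((e ⇨ ⊥) ⇨ ⊥) = (e ⇨ ⊥) ⇨ (⊥ : A) := neg_idem hm
  have hen : e ≤ (e ⇨ ⊥) ⇨ (⊥ : A) := by
    rw [← mul_le_iff]
    exact mul_imp_le _ _
  have hne : ∀ y : A, ((e ⇨ ⊥) ⇨ ⊥) ⇨ (e ⇨ y) = e ⇨ y := fun y => by
    rw [← mul_himp', idem_mul_of_le hn hen]
  have h10 : ∀ x : A, (e ⇨ x) ⇨ ((e ⇨ ⊥) ⇨ ⊥) = (e ⇨ ⊥) ⇨ (⊥ : A) := fun x => by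
    rw [← mul_himp', _root_.mul_comm, idem_mul_of_ge hm (imp_mono_right e (bot_le' x))]
  have hmeet : ∀ z : A, z * ((e ⇨ ⊥) ⇨ ⊥) =
      ((e ⇨ ⊥) ⇨ ⊥) * (((e ⇨ ⊥) ⇨ ⊥) ⇨ z) := fun z => by
    rw [idem_mul_imp hn, _root_.mul_comm]
  refine ⟨fun x y => ?_, fun x y => ?_, ?_⟩
  · unfold retract
    rw [hv.map_mul, idem_imp_mul he]
    cases v x <;> cases v y <;> simp only [cond_true, cond_false, Bool.and_true, Bool.and_false,
      _root_.mul_one]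
    · rw [mul_mul_mul_comm, hn]
    · rw [mul_right_comm]
    · rw [_root_.mul_assoc]
  · unfold retract
    rw [hv.map_himp, idem_imp_imp he]
    cases v x <;> cases v y <;> simp only [cond_true, cond_false, Bool.or_true, Bool.or_false,
      _root_.mul_one, Bool.not_true, Bool.not_false]
    -- Both values false: `¬¬e ⇨ ·` preserves products, sends `¬¬e` to `1` and fixes `e ⇨ y`, since
    -- `e ≤ ¬¬e`.
    · rw [mul_himp', idem_imp_mul hn, himp_self', _root_.mul_one, hne]
    · rw [mul_himp', hne]
    -- Only `v x` true: the product with `¬¬e` is a meet, which implication preserves, and `e ⇨ x`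
    -- implies `¬¬e` exactly to degree `¬¬e` because `¬e ≤ e ⇨ x`.
    · conv_rhs => rw [hmeet, imp_div, h10]
      rw [hmeet]
  · unfold retract
    rw [hv.map_bot, cond_false]
    exact le_antisymm (mul_imp_le _ _) (bot_le' _)

/-- A homomorphism from a finite bounded hoop onto one with a two-valued homomorphism has a
section. -/
theorem exists_section {F A : Type*} [BddHoop F] [BddHoop A] [Finite F] {g : F → A}
    (hg : IsHom g) (hs : Function.Surjective g) {v : A → Bool} (hv : IsBoolHom v) :
    ∃ s : A → F, IsHom s ∧ ∀ a, g (s a) = a := by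
  classical
  -- The product of the finitely many elements over `1` lies below each of them and is again over
  -- `1`.
  obtain ⟨e, he1, hle⟩ : ∃ e : F, g e = 1 ∧ ∀ x, g x = 1 → e ≤ x := by
    set S : Finset F := (Set.toFinite {x : F | g x = 1}).toFinset with hS
    have hmem : ∀ x, x ∈ S ↔ g x = 1 := fun x => by simp [hS]
    refine ⟨∏ x ∈ S, x, ?_, fun x hx => ?_⟩
    · refine Finset.prod_induction (fun x => x) (fun x => g x = 1) (fun a b ha hb => ?_)
        hg.map_one fun x hx => (hmem x).1 hx
      rw [hg.map_mul, ha, hb, _root_.mul_one]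
    · rw [← Finset.mul_prod_erase S _ ((hmem x).2 hx)]
      exact mul_le_left' _ _
  have he : e * e = e :=
    le_antisymm (mul_le_left' _ _) (hle _ (by rw [hg.map_mul, he1, _root_.mul_one]))
  have key : ∀ x y, g x = g y → e ⇨ x ≤ e ⇨ y := fun x y h => by
    rw [le_def, ← idem_imp_imp he]
    exact hle _ (by rw [hg.map_himp, h, himp_self'])
  have hτ : IsHom (retract e (v ∘ g)) := retract_isHom he
    { map_mul := fun x y => by simp [hg.map_mul, hv.map_mul]
      map_himp := fun x y => by simp [hg.map_himp, hv.map_himp]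
      map_bot := by simp [hg.map_bot, hv.map_bot] }
  have hwd : ∀ x y, g x = g y → retract e (v ∘ g) x = retract e (v ∘ g) y := fun x y h => by
    simp only [retract, Function.comp, h, le_antisymm (key x y h) (key y x h.symm)]
  -- Over `A` the element `e` becomes `1`, so `e ⇨ x` becomes `g x` and the factor `¬¬e` disappears.
  have hgτ : ∀ x, g (retract e (v ∘ g) x) = g x := fun x => by
    have hneg : g ((e ⇨ ⊥) ⇨ ⊥) = 1 := by
      rw [hg.map_himp, hg.map_himp, he1, one_imp, himp_self']
    unfold retract
    rw [hg.map_mul, hg.map_himp, he1, one_imp]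
    cases (v ∘ g) x <;> simp [hneg, hg.map_one]
  have hinv := Function.surjInv_eq hs
  have hsg : ∀ x, retract e (v ∘ g) (Function.surjInv hs (g x)) = retract e (v ∘ g) x :=
    fun x => hwd _ _ (hinv _)
  refine ⟨fun a => retract e (v ∘ g) (Function.surjInv hs a), ⟨fun a b => ?_, fun a b => ?_, ?_⟩,
    fun a => by rw [hgτ, hinv]⟩
  · rw [← hτ.map_mul]
    exact hwd _ _ (by simp only [hg.map_mul, hinv])
  · rw [← hτ.map_himp]
    exact hwd _ _ (by simp only [hg.map_himp, hinv])
  · rw [← hτ.map_bot]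
    exact hwd _ _ (by simp only [hg.map_bot, hinv])

end BddHoop

/-! ## Quotients, free algebras and projectivity -/

namespace AlgCongruence

variable {L : FirstOrder.Language.{0, 0}}

/-- The kernel of a homomorphism. -/
def ker {A B : Type*} [L.Structure A] [L.Structure B] (h : A →[L] B) : AlgCongruence L A where
  r a b := h a = h b
  iseqv := ⟨fun _ => rfl, Eq.symm, Eq.trans⟩
  compat f x y hxy := by
    rw [h.map_fun, h.map_fun]
    exact congrArg _ (funext hxy)

variable [L.IsAlgebraic]

/-- The canonical homomorphism onto a quotient algebra. -/
def mkHom {A : Type*} [L.Structure A] (θ : AlgCongruence L A) : A →[L] θ.QuotientAlg where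
  toFun := Quotient.mk θ.toSetoid
  map_fun' f x := by
    let : L.Prestructure θ.toSetoid :=
      { toStructure := inferInstance
        fun_equiv := fun x y h => θ.compat _ x y h
        rel_equiv := fun {_} {r} _ _ _ => isEmptyElim r }
    exact (funMap_quotient_mk' θ.toSetoid f x).symm
  map_rel' r := isEmptyElim r

theorem mkHom_surjective {A : Type*} [L.Structure A] (θ : AlgCongruence L A) :
    Function.Surjective θ.mkHom := Quotient.mk_surjective

theorem mkHom_eq_iff {A : Type*} [L.Structure A] (θ : AlgCongruence L A) {a b : A} :
    θ.mkHom a = θ.mkHom b ↔ θ.r a b := Quotient.eq (r := θ.toSetoid)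

/-- The homomorphism out of a quotient algebra induced by one whose kernel contains the
congruence. -/
def liftHom {A B : Type*} [L.Structure A] [L.Structure B] (θ : AlgCongruence L A) (h : A →[L] B)
    (hθ : ∀ a b, θ.r a b → h a = h b) : θ.QuotientAlg →[L] B where
  toFun := Quotient.lift h hθ
  map_fun' {n} f x := by
    obtain ⟨y, rfl⟩ : ∃ y : Fin n → A, x = θ.mkHom ∘ y :=
      ⟨fun i => (θ.mkHom_surjective (x i)).choose,
        funext fun i => (θ.mkHom_surjective (x i)).choose_spec.symm⟩
    rw [← θ.mkHom.map_fun]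
    exact h.map_fun f y
  map_rel' r := isEmptyElim r

/-- The pullback of a congruence along a homomorphism. -/
def comap {A B : Type*} [L.Structure A] [L.Structure B] (h : A →[L] B) (φ : AlgCongruence L B) :
    AlgCongruence L A := ker (φ.mkHom.comp h)

theorem comap_r {A B : Type*} [L.Structure A] [L.Structure B] (h : A →[L] B)
    (φ : AlgCongruence L B) (a b : A) : (comap h φ).r a b ↔ φ.r (h a) (h b) :=
  φ.mkHom_eq_iff

end AlgCongruence

namespace AlgVariety

variable {L : FirstOrder.Language.{0, 0}}

theorem Mem.of_surjective {V : AlgVariety L} {A B : Type*} [L.Structure A] [L.Structure B]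
    (hA : V.Mem A) (h : A →[L] B) (hs : Function.Surjective h) : V.Mem B := by
  intro e he v
  obtain ⟨w, rfl⟩ : ∃ w : ℕ → A, v = h ∘ w :=
    ⟨fun i => (hs (v i)).choose, funext fun i => (hs (v i)).choose_spec.symm⟩
  rw [HomClass.realize_term, HomClass.realize_term, hA e he w]

variable [L.IsAlgebraic]

/-- Evaluation of terms, as a homomorphism on the term algebra. -/
def evalHom {X B : Type*} [L.Structure B] (φ : X → B) : L.Term X →[L] B where
  toFun t := t.realize φ
  map_fun' _ _ := rfl
  map_rel' r := isEmptyElim r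

theorem evalHom_comp_var {X B : Type*} [L.Structure B] (h : L.Term X →[L] B) (t : L.Term X) :
    h t = t.realize fun x => h (Term.var x) := by
  induction t with
  | var x => rfl
  | func f ts ih =>
    rw [Term.realize_func]
    refine (h.map_fun f ts).trans (congrArg _ (funext ih))

theorem realize_term_eq_subst {X Y : Type*} (σ : Y → L.Term X) (t : L.Term Y) :
    t.realize σ = t.subst σ := by
  induction t with
  | var x => rfl
  | func f ts ih => exact congrArg (Term.func f) (funext ih)

theorem free_mem (V : AlgVariety L) (X : Type*) : V.Mem (V.Free X) := by
  intro e he v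
  have hs := (V.freeCongruence X).mkHom_surjective
  obtain ⟨σ, rfl⟩ : ∃ σ : ℕ → L.Term X, v = (V.freeCongruence X).mkHom ∘ σ :=
    ⟨fun i => (hs (v i)).choose, funext fun i => (hs (v i)).choose_spec.symm⟩
  rw [HomClass.realize_term, HomClass.realize_term, realize_term_eq_subst, realize_term_eq_subst]
  exact (AlgCongruence.mkHom_eq_iff _).2 fun θ hθ => hθ (_, _) ⟨e, he, σ, rfl⟩

/-- The homomorphism from the free algebra extending a map of the generators. -/
def freeLift (V : AlgVariety L) {X B : Type*} [L.Structure B] (hB : V.Mem B) (φ : X → B) :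
    V.Free X →[L] B :=
  (V.freeCongruence X).liftHom (evalHom φ) fun a b hab => by
    refine hab (AlgCongruence.ker (evalHom φ)) ?_
    rintro p ⟨e, he, σ, rfl⟩
    show (e.1.subst σ).realize φ = (e.2.subst σ).realize φ
    rw [Term.realize_subst, Term.realize_subst]
    exact hB e he _

theorem freeLift_mk (V : AlgVariety L) {X B : Type*} [L.Structure B] (hB : V.Mem B) (φ : X → B)
    (t : L.Term X) : V.freeLift hB φ ((V.freeCongruence X).mkHom t) = t.realize φ := rfl

theorem free_fg (V : AlgVariety L) (X : Type*) [Finite X] : Structure.FG L (V.Free X) := by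
  rw [Structure.fg_iff]
  refine ⟨Set.range fun x => (V.freeCongruence X).mkHom (Term.var x), Set.finite_range _, ?_⟩
  rw [eq_top_iff]
  rintro a -
  obtain ⟨t, rfl⟩ := (V.freeCongruence X).mkHom_surjective a
  rw [Substructure.mem_closure_iff_exists_term]
  refine ⟨t.relabel fun x => ⟨_, x, rfl⟩, ?_⟩
  rw [Term.realize_relabel, evalHom_comp_var]
  rfl

/-- If every homomorphism from a finite member of a locally finite variety onto a nontrivial
algebra has a section, then the nontrivial finitely presented algebras are projective. -/
theorem finitelyPresentedProjective_of_section (V : AlgVariety L)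
    (hV : AlgVariety.LocallyFinite.{u} V)
    (hsec : ∀ (F A : Type u) [L.Structure F] [L.Structure A], V.Mem F → Finite F → Nontrivial A →
      ∀ g : F →[L] A, Function.Surjective g → ∃ s : A →[L] F, ∀ a, g (s a) = a) :
    FinitelyPresentedProjective.{u} V := by
  rintro A _ ⟨hA, n, θ, -, ⟨i⟩⟩ hnt
  refine ⟨hA, fun B C _ _ hB hC h p hp => ?_⟩
  let q : L.Term (Fin n) →[L] A := (i.toHom.comp θ.mkHom).comp (V.freeCongruence (Fin n)).mkHom
  have hq : Function.Surjective q :=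
    (i.surjective.comp θ.mkHom_surjective).comp (AlgCongruence.mkHom_surjective _)
  -- The lift places the free algebra in universe `u`, where local finiteness and `hsec` apply.
  let X : Type u := ULift (Fin n)
  let ψ : X → A := fun x => q (Term.var x.down)
  have hg : Function.Surjective (V.freeLift hA ψ) := fun a => by
    obtain ⟨t, rfl⟩ := hq a
    refine ⟨(V.freeCongruence X).mkHom (t.relabel ULift.up), ?_⟩
    rw [freeLift_mk, Term.realize_relabel, evalHom_comp_var]
    rfl
  obtain ⟨s, hs⟩ := hsec (V.Free X) A (V.free_mem X) (hV _ (V.free_mem X) (V.free_fg X)) hnt _ hg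
  choose b hb using hp
  -- Each generator goes to a chosen `p`-preimage of its value under `h ∘ ψ`; precomposing with the
  -- section gives the lift of `h`.
  refine ⟨(V.freeLift hB fun x => b (h (ψ x))).comp s, ?_⟩
  ext a
  show p (V.freeLift hB (fun x => b (h (ψ x))) (s a)) = h a
  conv_rhs => rw [← hs a]
  obtain ⟨t, ht⟩ := (V.freeCongruence X).mkHom_surjective (s a)
  rw [← ht, freeLift_mk, freeLift_mk, ← HomClass.realize_term, ← HomClass.realize_term]
  congr 1
  funext x
  exact hb _

end AlgVariety

/-- Every finite nontrivial algebra has a subdirectly irreducible quotient. -/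
theorem exists_subdirectlyIrreducible_quotient {L : FirstOrder.Language.{0, 0}} [L.IsAlgebraic]
    (A : Type*) [L.Structure A] [Finite A] [Nontrivial A] :
    ∃ θ : AlgCongruence L A, SubdirectlyIrreducible L θ.QuotientAlg := by
  obtain ⟨a, b, hab⟩ := exists_pair_ne A
  -- A congruence maximal among those not identifying `a` and `b` will do. Maximality is sought
  -- among graphs, which form a finite family of sets.
  let graph : AlgCongruence L A → Set (A × A) := fun θ => {p | θ.r p.1 p.2}
  have hne : (graph '' {θ | ¬ θ.r a b}).Nonempty :=
    ⟨_, AlgCongruence.ker (Hom.id L A), hab, rfl⟩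
  obtain ⟨_, ⟨⟨θ, hθ, rfl⟩, hmax⟩⟩ := (Set.toFinite (graph '' {θ | ¬ θ.r a b})).exists_maximal hne
  refine ⟨θ, θ.mkHom a, θ.mkHom b, fun h => hθ (θ.mkHom_eq_iff.1 h), fun φ hφ => ?_⟩
  by_contra hab'
  obtain ⟨c, d, hcd, hr⟩ := hφ
  obtain ⟨c, rfl⟩ := θ.mkHom_surjective c
  obtain ⟨d, rfl⟩ := θ.mkHom_surjective d
  -- If `φ` kept the classes of `a` and `b` apart, its pullback would contain `θ` and still omit
  -- `(a, b)`; maximality would make `φ` trivial.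
  have hle : graph θ ⊆ graph (AlgCongruence.comap θ.mkHom φ) := fun p hp => by
    refine (AlgCongruence.comap_r _ _ _ _).2 ?_
    rw [θ.mkHom_eq_iff.2 hp]
  have := hmax ⟨_, fun h => hab' ((AlgCongruence.comap_r _ _ _ _).1 h), rfl⟩ hle
  exact hcd (θ.mkHom_eq_iff.2 (this (a := (c, d)) ((AlgCongruence.comap_r _ _ _ _).2 hr)))

/-- If the finite subdirectly irreducible members of a variety map onto `T`, then all its finite
nontrivial members have a homomorphism to `T`. -/
theorem FiniteSIMapOnto.exists_hom {L : FirstOrder.Language.{0, 0}} [L.IsAlgebraic]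
    {V : AlgVariety L} {T : Type} [L.Structure T] (h : FiniteSIMapOnto.{u} V T) (A : Type u)
    [L.Structure A] (hA : V.Mem A) [Finite A] [Nontrivial A] : Nonempty (A →[L] T) := by
  obtain ⟨θ, hθ⟩ := exists_subdirectlyIrreducible_quotient (L := L) A
  obtain ⟨f, -⟩ := h θ.QuotientAlg (hA.of_surjective _ θ.mkHom_surjective)
    (Finite.of_surjective _ θ.mkHom_surjective) hθ
  exact ⟨f.comp θ.mkHom⟩

theorem eq_vec_two {A : Type*} (x : Fin 2 → A) : x = ![x 0, x 1] := by
  funext i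
  fin_cases i <;> rfl

theorem comp_vec_two {A B : Type*} (f : A → B) (a b : A) : f ∘ ![a, b] = ![f a, f b] := by
  funext i
  fin_cases i <;> rfl

/-! ## Bounded hoops as algebras -/

namespace Hoop

variable {A B : Type*} [hoopLang.Structure A] [hoopLang.Structure B]

theorem map_mul (f : A →[hoopLang] B) (a b : A) : f (mul a b) = mul (f a) (f b) := 
  (f.map_fun _ _).trans (congrArg _ (comp_vec_two f a b))

theorem map_imp (f : A →[hoopLang] B) (a b : A) : f (imp a b) = imp (f a) (f b) := 
  (f.map_fun _ _).trans (congrArg _ (comp_vec_two f a b))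

theorem map_zero (f : A →[hoopLang] B) : f (zero A) = zero B :=
  (f.map_fun _ _).trans (congrArg _ (Subsingleton.elim _ _))

/-- A map preserving the operations of bounded hoops is a homomorphism. -/
def homMk (f : A → B) (hmul : ∀ a b, f (mul a b) = mul (f a) (f b))
    (himp : ∀ a b, f (imp a b) = imp (f a) (f b)) (hzero : f (zero A) = zero B)
    (hone : f (one A) = one B) : A →[hoopLang] B where
  toFun := f
  map_fun' {n} s x := by
    cases s with
    | mul =>
      rw [eq_vec_two x, comp_vec_two]
      exact hmul _ _
    | imp =>
      rw [eq_vec_two x, comp_vec_two]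
      exact himp _ _
    | zero =>
      rw [Subsingleton.elim x ![], Subsingleton.elim (f ∘ _) (![])]
      exact hzero
    | one =>
      rw [Subsingleton.elim x ![], Subsingleton.elim (f ∘ _) (![])]
      exact hone
  map_rel' r := isEmptyElim r

end Hoop

/-- The operational form of a bounded hoop. -/
abbrev IsBoundedHoop.toBddHoop {A : Type*} [hoopLang.Structure A] (h : IsBoundedHoop A) :
    BddHoop A where
  mul := Hoop.mul
  one := Hoop.one A
  himp := Hoop.imp
  bot := Hoop.zero A
  mul_assoc := h.mul_assoc
  mul_comm := h.mul_comm
  one_mul := h.one_mul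
  mul_one a := (h.mul_comm _ _).trans (h.one_mul a)
  himp_self' := h.imp_self
  div' := h.div
  mul_himp' := h.mul_imp
  bot_himp' := h.zero_le

theorem AlgVariety.finitelyPresentedProjective_hoop (V : AlgVariety hoopLang)
    (hV : ∀ (A : Type u) [hoopLang.Structure A], V.Mem A → IsBoundedHoop A)
    (hlf : AlgVariety.LocallyFinite.{u} V) (hsi : FiniteSIMapOnto.{u} V Bool) :
    FinitelyPresentedProjective.{u} V := by
  refine V.finitelyPresentedProjective_of_section hlf fun F A _ _ hF hfin hnt g hg => ?_
  have hA := hF.of_surjective g hg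
  have := Finite.of_surjective g hg
  obtain ⟨v⟩ := hsi.exists_hom A hA
  let := (hV F hF).toBddHoop
  let := (hV A hA).toBddHoop
  obtain ⟨s, hs, hgs⟩ := BddHoop.exists_section (g := g)
    ⟨Hoop.map_mul g, Hoop.map_imp g, Hoop.map_zero g⟩ hg (v := v)
    ⟨Hoop.map_mul v, Hoop.map_imp v, Hoop.map_zero v⟩
  exact ⟨Hoop.homMk s hs.map_mul hs.map_himp hs.map_bot hs.map_one, hgs⟩

/-! ## BL-algebras -/

namespace IsBLAlgebra

variable {A : Type*} [blLang.Structure A]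

/-- The lattice reduct of a BL-algebra. -/
abbrev toLattice (h : IsBLAlgebra A) : Lattice A :=
  letI : Max A := ⟨BL.sup⟩
  letI : Min A := ⟨BL.inf⟩
  Lattice.mk' h.sup_comm h.sup_assoc h.inf_comm h.inf_assoc h.sup_inf_self h.inf_sup_self

theorem mul_le_iff (h : IsBLAlgebra A) :
    letI := h.toLattice
    ∀ a b c : A, BL.mul a b ≤ c ↔ a ≤ BL.imp b c := by
  let := h.toLattice
  intro a b c
  rw [← inf_eq_left, ← inf_eq_left]
  exact h.residuation a b c

theorem le_one' (h : IsBLAlgebra A) :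
    letI := h.toLattice
    ∀ a : A, a ≤ BL.one A := by
  let := h.toLattice
  exact fun a => inf_eq_left.1 (h.le_one a)

theorem zero_le' (h : IsBLAlgebra A) :
    letI := h.toLattice
    ∀ a : A, BL.zero A ≤ a := by
  let := h.toLattice
  exact fun a => inf_eq_left.1 (h.zero_le a)

theorem imp_eq_one_iff (h : IsBLAlgebra A) :
    letI := h.toLattice
    ∀ a b : A, BL.imp a b = BL.one A ↔ a ≤ b := by
  let := h.toLattice
  intro a b
  rw [← (h.le_one' _).ge_iff_eq, ← h.mul_le_iff, h.one_mul]

theorem mul_mono (h : IsBLAlgebra A) :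
    letI := h.toLattice
    ∀ a b c : A, a ≤ b → BL.mul a c ≤ BL.mul b c := by
  let := h.toLattice
  intro a b c hab
  rw [h.mul_le_iff]
  refine hab.trans ?_
  rw [← h.mul_le_iff]

theorem mul_le_left (h : IsBLAlgebra A) :
    letI := h.toLattice
    ∀ a b : A, BL.mul a b ≤ a := by
  let := h.toLattice
  intro a b
  have := h.mul_mono b _ a (h.le_one' b)
  rwa [h.one_mul, h.mul_comm] at this

theorem mul_imp_le (h : IsBLAlgebra A) :
    letI := h.toLattice
    ∀ a b : A, BL.mul a (BL.imp a b) ≤ b := by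
  let := h.toLattice
  intro a b
  rw [h.mul_comm, h.mul_le_iff]

/-- By residuation multiplication is a left adjoint, so it preserves joins. -/
theorem mul_sup (h : IsBLAlgebra A) (a b c : A) :
    BL.mul a (BL.sup b c) = BL.sup (BL.mul a b) (BL.mul a c) := by
  let := h.toLattice
  rw [h.mul_comm, h.mul_comm a b, h.mul_comm a c]
  apply le_antisymm
  · rw [h.mul_le_iff]
    apply sup_le
    · rw [← h.mul_le_iff]
      exact le_sup_left
    · rw [← h.mul_le_iff]
      exact le_sup_right
  · exact sup_le (h.mul_mono _ _ _ le_sup_left) (h.mul_mono _ _ _ le_sup_right)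

theorem inf_eq (h : IsBLAlgebra A) (a b : A) : BL.inf a b = BL.mul a (BL.imp a b) := by
  let := h.toLattice
  apply le_antisymm
  · have h1 : BL.inf a b ≤ a := inf_le_left
    have h2 : BL.inf a b ≤ b := inf_le_right
    have h3 : BL.mul a (BL.imp a (BL.inf a b)) = BL.inf a b := by
      rw [h.div, (h.imp_eq_one_iff _ _).2 h1, h.mul_comm, h.one_mul]
    rw [← h3, h.mul_comm, h.mul_comm a]
    apply h.mul_mono
    rw [← h.mul_le_iff, h.mul_comm, h3]
    exact h2
  · exact le_inf (h.mul_le_left _ _) (h.mul_imp_le _ _)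

/-- Prelinearity splits the right side `w` as `w · (a → b) ∨ w · (b → a)`, whose parts lie below `b`
and `a`. With `inf_eq`, this makes the lattice operations terms in product and implication. -/
theorem sup_eq (h : IsBLAlgebra A) (a b : A) :
    BL.sup a b = BL.inf (BL.imp (BL.imp a b) b) (BL.imp (BL.imp b a) a) := by
  let := h.toLattice
  apply le_antisymm
  · have key : ∀ x y : A, BL.sup x y ≤ BL.imp (BL.imp x y) y := fun x y => by
      apply sup_le
      · rw [← h.mul_le_iff]
        exact h.mul_imp_le _ _
      · rw [← h.mul_le_iff]
        exact h.mul_le_left _ _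
    refine le_inf (key a b) ?_
    rw [h.sup_comm]
    exact key b a
  · set w := BL.inf (BL.imp (BL.imp a b) b) (BL.imp (BL.imp b a) a) with hw
    have h1 : w ≤ BL.imp (BL.imp a b) b := inf_le_left
    have h2 : w ≤ BL.imp (BL.imp b a) a := inf_le_right
    have h3 : w = BL.sup (BL.mul w (BL.imp a b)) (BL.mul w (BL.imp b a)) := by
      rw [← h.mul_sup, h.prel, h.mul_comm, h.one_mul]
    rw [h3]
    refine sup_le ?_ ?_
    · exact ((h.mul_le_iff _ _ _).2 h1).trans le_sup_right
    · exact ((h.mul_le_iff _ _ _).2 h2).trans le_sup_left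

/-- The bounded hoop reduct of a BL-algebra. -/
abbrev toBddHoop (h : IsBLAlgebra A) : BddHoop A where
  mul := BL.mul
  one := BL.one A
  himp := BL.imp
  bot := BL.zero A
  mul_assoc := h.mul_assoc
  mul_comm := h.mul_comm
  one_mul := h.one_mul
  mul_one a := (h.mul_comm _ _).trans (h.one_mul a)
  himp_self' a := by
    let := h.toLattice
    exact (h.imp_eq_one_iff a a).2 le_rfl
  div' := h.div
  mul_himp' a b c := by
    let := h.toLattice
    show BL.imp (BL.mul a b) c = BL.imp a (BL.imp b c)
    refine eq_of_forall_le_iff fun d => ?_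
    rw [← h.mul_le_iff, ← h.mul_le_iff, ← h.mul_le_iff, h.mul_assoc]
  bot_himp' a := by
    let := h.toLattice
    exact (h.imp_eq_one_iff _ a).2 (h.zero_le' a)

theorem map_inf {B : Type*} [blLang.Structure B] (hA : IsBLAlgebra A) (hB : IsBLAlgebra B)
    {f : A → B} (hmul : ∀ a b, f (BL.mul a b) = BL.mul (f a) (f b))
    (himp : ∀ a b, f (BL.imp a b) = BL.imp (f a) (f b)) (a b : A) :
    f (BL.inf a b) = BL.inf (f a) (f b) := by
  rw [hA.inf_eq, hB.inf_eq, hmul, himp]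

theorem map_sup {B : Type*} [blLang.Structure B] (hA : IsBLAlgebra A) (hB : IsBLAlgebra B)
    {f : A → B} (hmul : ∀ a b, f (BL.mul a b) = BL.mul (f a) (f b))
    (himp : ∀ a b, f (BL.imp a b) = BL.imp (f a) (f b)) (a b : A) :
    f (BL.sup a b) = BL.sup (f a) (f b) := by
  rw [hA.sup_eq, hB.sup_eq, hA.map_inf hB hmul himp, himp, himp, himp, himp]

end IsBLAlgebra

namespace BL

variable {A B : Type*} [blLang.Structure A] [blLang.Structure B]

theorem map_mul (f : A →[blLang] B) (a b : A) : f (mul a b) = mul (f a) (f b) := 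
  (f.map_fun _ _).trans (congrArg _ (comp_vec_two f a b))

theorem map_imp (f : A →[blLang] B) (a b : A) : f (imp a b) = imp (f a) (f b) := 
  (f.map_fun _ _).trans (congrArg _ (comp_vec_two f a b))

theorem map_zero (f : A →[blLang] B) : f (zero A) = zero B :=
  (f.map_fun _ _).trans (congrArg _ (Subsingleton.elim _ _))

/-- A map preserving the operations of BL-algebras is a homomorphism. -/
def homMk (f : A → B) (hsup : ∀ a b, f (sup a b) = sup (f a) (f b))
    (hinf : ∀ a b, f (inf a b) = inf (f a) (f b))
    (hmul : ∀ a b, f (mul a b) = mul (f a) (f b))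
    (himp : ∀ a b, f (imp a b) = imp (f a) (f b)) (hzero : f (zero A) = zero B)
    (hone : f (one A) = one B) : A →[blLang] B where
  toFun := f
  map_fun' {n} s x := by
    cases s with
    | sup =>
      rw [eq_vec_two x, comp_vec_two]
      exact hsup _ _
    | inf =>
      rw [eq_vec_two x, comp_vec_two]
      exact hinf _ _
    | mul =>
      rw [eq_vec_two x, comp_vec_two]
      exact hmul _ _
    | imp =>
      rw [eq_vec_two x, comp_vec_two]
      exact himp _ _
    | zero =>
      rw [Subsingleton.elim x ![], Subsingleton.elim (f ∘ _) (![])]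
      exact hzero
    | one =>
      rw [Subsingleton.elim x ![], Subsingleton.elim (f ∘ _) (![])]
      exact hone
  map_rel' r := isEmptyElim r

end BL

theorem AlgVariety.finitelyPresentedProjective_bl (V : AlgVariety blLang)
    (hV : ∀ (A : Type u) [blLang.Structure A], V.Mem A → IsBLAlgebra A)
    (hlf : AlgVariety.LocallyFinite.{u} V) (hsi : FiniteSIMapOnto.{u} V Bool) :
    FinitelyPresentedProjective.{u} V := by
  refine V.finitelyPresentedProjective_of_section hlf fun F A _ _ hF hfin hnt g hg => ?_
  have hA := hF.of_surjective g hg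
  have := Finite.of_surjective g hg
  obtain ⟨v⟩ := hsi.exists_hom A hA
  let := (hV F hF).toBddHoop
  let := (hV A hA).toBddHoop
  obtain ⟨s, hs, hgs⟩ := BddHoop.exists_section (g := g)
    ⟨BL.map_mul g, BL.map_imp g, BL.map_zero g⟩ hg (v := v)
    ⟨BL.map_mul v, BL.map_imp v, BL.map_zero v⟩
  exact ⟨BL.homMk s ((hV A hA).map_sup (hV F hF) hs.map_mul hs.map_himp)
    ((hV A hA).map_inf (hV F hF) hs.map_mul hs.map_himp) hs.map_mul hs.map_himp hs.map_bot
    hs.map_one, hgs⟩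

/-! ## Stonean BL-algebras -/

/-- The congruences of `e` and `d` meet in equality: `x = x · e ∨ x · d`, and each part is bounded
by residuation. -/
theorem IsBLAlgebra.eq_of_imp_eq {A : Type*} [blLang.Structure A] (h : IsBLAlgebra A)
    {e d a b : A} (hed : BL.sup e d = BL.one A) (he : BL.imp e a = BL.imp e b)
    (hd : BL.imp d a = BL.imp d b) : a = b := by
  let := h.toLattice
  have key : ∀ x y : A, BL.imp e x = BL.imp e y → BL.imp d x = BL.imp d y → x ≤ y :=
    fun x y hex hdx => by
      have h1 : x = BL.sup (BL.mul x e) (BL.mul x d) := by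
        rw [← h.mul_sup, hed, h.mul_comm, h.one_mul]
      rw [h1]
      refine sup_le ?_ ?_
      · rw [h.mul_le_iff, ← hex, ← h.mul_le_iff]
        exact h.mul_le_left _ _
      · rw [h.mul_le_iff, ← hdx, ← h.mul_le_iff]
        exact h.mul_le_left _ _
  exact le_antisymm (key a b he hd) (key b a he.symm hd.symm)

/-- The congruence of a BL-algebra attached to an idempotent. -/
def IsBLAlgebra.idemCongruence {A : Type*} [blLang.Structure A] (h : IsBLAlgebra A) {e : A}
    (he : BL.mul e e = e) : AlgCongruence blLang A where
  r a b := BL.imp e a = BL.imp e b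
  iseqv := ⟨fun _ => rfl, Eq.symm, Eq.trans⟩
  compat {n} s x y hxy := by
    -- The relation is the kernel of `BL.imp e`, which preserves product and implication, hence also
    -- join and meet.
    have hmul : ∀ a b : A, BL.imp e (BL.mul a b) = BL.mul (BL.imp e a) (BL.imp e b) := by
      let := h.toBddHoop
      exact BddHoop.idem_imp_mul he
    have himp : ∀ a b : A, BL.imp e (BL.imp a b) = BL.imp (BL.imp e a) (BL.imp e b) := by
      let := h.toBddHoop
      exact BddHoop.idem_imp_imp he
    cases s with
    | sup =>
      rw [eq_vec_two x, eq_vec_two y]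
      refine (h.map_sup h hmul himp _ _).trans (Eq.trans ?_ (h.map_sup h hmul himp _ _).symm)
      rw [hxy 0, hxy 1]
    | inf =>
      rw [eq_vec_two x, eq_vec_two y]
      refine (h.map_inf h hmul himp _ _).trans (Eq.trans ?_ (h.map_inf h hmul himp _ _).symm)
      rw [hxy 0, hxy 1]
    | mul =>
      rw [eq_vec_two x, eq_vec_two y]
      refine (hmul _ _).trans (Eq.trans ?_ (hmul _ _).symm)
      rw [hxy 0, hxy 1]
    | imp =>
      rw [eq_vec_two x, eq_vec_two y]
      refine (himp _ _).trans (Eq.trans ?_ (himp _ _).symm)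
      rw [hxy 0, hxy 1]
    | zero => rw [Subsingleton.elim x y]
    | one => rw [Subsingleton.elim x y]

/-- In a subdirectly irreducible BL-algebra, of two idempotents with join `1` one is `1`. -/
theorem IsBLAlgebra.eq_one_or_eq_one_of_sup {A : Type*} [blLang.Structure A] (h : IsBLAlgebra A)
    (hsi : SubdirectlyIrreducible blLang A) {e d : A} (he : BL.mul e e = e)
    (hd : BL.mul d d = d) (hed : BL.sup e d = BL.one A) : e = BL.one A ∨ d = BL.one A := by
  by_contra! hne
  obtain ⟨a, b, hab, hmon⟩ := hsi
  let := h.toBddHoop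
  have hr : ∀ c : A, BL.imp c c = BL.imp c (BL.one A) := fun c =>
    (BddHoop.himp_self' c).trans (BddHoop.imp_one c).symm
  -- The pairs `(e, 1)` and `(d, 1)` make both congruences nontrivial, so both identify `a` and `b`.
  exact hab (h.eq_of_imp_eq hed (hmon (h.idemCongruence he) ⟨e, _, hne.1, hr e⟩)
    (hmon (h.idemCongruence hd) ⟨d, _, hne.2, hr d⟩))

/-- Multiply `¬a ∨ ¬¬a = 1` by `¬a`; the second summand vanishes. -/
theorem IsStoneanBL.neg_idem {A : Type*} [blLang.Structure A] (h : IsStoneanBL A) (a : A) :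
    BL.mul (BL.neg a) (BL.neg a) = BL.neg a := by
  have hBL := h.toIsBLAlgebra
  have h0 : BL.mul (BL.neg a) (BL.neg (BL.neg a)) = BL.zero A := by
    let := hBL.toLattice
    exact le_antisymm (hBL.mul_imp_le _ _) (hBL.zero_le' _)
  have h1 : BL.neg a = BL.sup (BL.mul (BL.neg a) (BL.neg a)) (BL.zero A) := by
    rw [← h0, ← hBL.mul_sup, h.stone, hBL.mul_comm, hBL.one_mul]
  let := hBL.toLattice
  have h2 : BL.sup (BL.mul (BL.neg a) (BL.neg a)) (BL.zero A) = BL.mul (BL.neg a) (BL.neg a) :=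
    sup_eq_left.2 (hBL.zero_le' _)
  rw [h2] at h1
  exact h1.symm

/-- A subdirectly irreducible Stonean BL-algebra has the two-element algebra as a homomorphic
image. -/
theorem IsStoneanBL.exists_hom_bool {A : Type*} [blLang.Structure A] (h : IsStoneanBL A)
    (hsi : SubdirectlyIrreducible blLang A) (hBool : IsBLAlgebra Bool) :
    ∃ f : A →[blLang] Bool, Function.Surjective f := by
  classical
  have hBL := h.toIsBLAlgebra
  let := hBL.toBddHoop
  -- Either `¬x = 1`, so that `x = 0`, or `¬¬x = 1`, so that `¬x = 0`.
  have hneg : ∀ x : A, x ≠ ⊥ → x ⇨ ⊥ = ⊥ := fun x hx => by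
    rcases hBL.eq_one_or_eq_one_of_sup hsi (h.neg_idem x) (h.neg_idem (BL.neg x)) (h.stone x)
      with h1 | h1
    · exact absurd (le_antisymm (BddHoop.le_def.2 h1) (BddHoop.bot_le' x)) hx
    · exact le_antisymm (BddHoop.le_def.2 h1) (BddHoop.bot_le' _)
  have h01 : (1 : A) ≠ ⊥ := fun h10 => by
    obtain ⟨a, b, hab, -⟩ := hsi
    have hall : ∀ x : A, x = ⊥ := fun x =>
      le_antisymm ((BddHoop.le_top' x).trans h10.le) (BddHoop.bot_le' x)
    exact hab ((hall a).trans (hall b).symm)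
  have hmul : ∀ x y : A, x * y = ⊥ ↔ x = ⊥ ∨ y = ⊥ := fun x y => by
    constructor
    · intro hxy
      by_contra! hne
      have h1 : x ≤ y ⇨ ⊥ := BddHoop.mul_le_iff.1 hxy.le
      rw [hneg y hne.2] at h1
      exact hne.1 (le_antisymm h1 (BddHoop.bot_le' x))
    · rintro (rfl | rfl)
      · exact le_antisymm (BddHoop.mul_le_left' _ _) (BddHoop.bot_le' _)
      · exact le_antisymm (BddHoop.mul_le_right' _ _) (BddHoop.bot_le' _)
  have himp : ∀ x y : A, x ⇨ y = ⊥ ↔ x ≠ ⊥ ∧ y = ⊥ := fun x y => by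
    constructor
    · intro hxy
      refine ⟨?_, le_antisymm ((BddHoop.le_imp x y).trans hxy.le) (BddHoop.bot_le' y)⟩
      rintro rfl
      exact h01 ((BddHoop.bot_himp' y).symm.trans hxy)
    · rintro ⟨hx, rfl⟩
      exact hneg x hx
  let f : A → Bool := fun x => decide (x ≠ ⊥)
  have fmul : ∀ x y : A, f (BL.mul x y) = BL.mul (f x) (f y) := fun x y => by
    show decide (x * y ≠ ⊥) = (decide (x ≠ ⊥) && decide (y ≠ ⊥))
    simp [hmul]
  have fimp : ∀ x y : A, f (BL.imp x y) = BL.imp (f x) (f y) := fun x y => by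
    show decide (x ⇨ y ≠ ⊥) = (!decide (x ≠ ⊥) || decide (y ≠ ⊥))
    by_cases hx : x = ⊥ <;> by_cases hy : y = ⊥ <;> simp [himp, hx, hy]
  have fzero : f ⊥ = false := by simp [f]
  have fone : f 1 = true := by simp [f, h01]
  refine ⟨BL.homMk f (hBL.map_sup hBool fmul fimp) (hBL.map_inf hBool fmul fimp) fmul fimp
    fzero fone, fun b => ?_⟩
  cases b
  · exact ⟨⊥, fzero⟩
  · exact ⟨1, fone⟩

/-! ## Boolean algebras -/

theorem isBooleanBL_bool : IsBooleanBL Bool where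
  sup_comm := by decide
  sup_assoc := by decide
  inf_comm := by decide
  inf_assoc := by decide
  sup_inf_self := by decide
  inf_sup_self := by decide
  inf_sup_distrib := by decide
  zero_le := by unfold BL.le; decide
  le_one := by unfold BL.le; decide
  inf_neg := by decide
  sup_neg := by decide
  mul_eq_inf := by decide
  imp_eq := by decide

namespace IsBooleanBL

variable {A : Type*} [blLang.Structure A]

/-- The Boolean algebra underlying a Boolean algebra in the language of BL-algebras. -/
abbrev toBooleanAlgebra (h : IsBooleanBL A) : BooleanAlgebra A :=
  letI : Max A := ⟨BL.sup⟩
  letI : Min A := ⟨BL.inf⟩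
  letI : Lattice A :=
    Lattice.mk' h.sup_comm h.sup_assoc h.inf_comm h.inf_assoc h.sup_inf_self h.inf_sup_self
  letI : DistribLattice A := DistribLattice.ofInfSupLe fun a b c => (h.inf_sup_distrib a b c).le
  { compl := BL.neg
    top := BL.one A
    bot := BL.zero A
    le_top := fun a => inf_eq_left.1 (h.le_one a)
    bot_le := fun a => inf_eq_left.1 (h.zero_le a)
    inf_compl_le_bot := fun a => (h.inf_neg a).le
    top_le_sup_compl := fun a => (h.sup_neg a).ge }

theorem isStoneanBL (h : IsBooleanBL A) : IsStoneanBL A := by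
  let := h.toBooleanAlgebra
  have hmul : ∀ a b : A, BL.mul a b = a ⊓ b := h.mul_eq_inf
  have himp : ∀ a b : A, BL.imp a b = aᶜ ⊔ b := h.imp_eq
  exact
    { sup_comm := h.sup_comm
      sup_assoc := h.sup_assoc
      inf_comm := h.inf_comm
      inf_assoc := h.inf_assoc
      sup_inf_self := h.sup_inf_self
      inf_sup_self := h.inf_sup_self
      zero_le := h.zero_le
      le_one := h.le_one
      mul_assoc := fun a b c => by simp only [hmul, _root_.inf_assoc]
      mul_comm := fun a b => by rw [hmul, hmul, _root_.inf_comm]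
      one_mul := fun a => (hmul _ _).trans (top_inf_eq _)
      residuation := fun a b c => by
        rw [hmul, himp]
        refine inf_eq_left.trans (Iff.trans ?_ inf_eq_left.symm)
        rw [← le_himp_iff, himp_eq, _root_.sup_comm]
      prel := fun a b => by
        rw [himp, himp]
        show (aᶜ ⊔ b) ⊔ (bᶜ ⊔ a) = ⊤
        rw [_root_.sup_comm bᶜ a, sup_sup_sup_comm, _root_.sup_comm aᶜ a, sup_compl_eq_top, top_sup_eq]
      div := fun a b => by
        rw [himp, himp, hmul, hmul, inf_sup_left, inf_sup_left, inf_compl_eq_bot,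
          inf_compl_eq_bot, bot_sup_eq, bot_sup_eq, _root_.inf_comm]
      stone := fun a => h.sup_neg (BL.neg a) }

theorem isBLAlgebra (h : IsBooleanBL A) : IsBLAlgebra A := h.isStoneanBL.toIsBLAlgebra

/-- The elements of a Boolean algebra are separated by its two-valued homomorphisms. -/
theorem exists_hom_bool_ne (h : IsBooleanBL A) {a b : A} (hab : a ≠ b) :
    ∃ f : A →[blLang] Bool, f a ≠ f b := by
  classical
  let := h.toBooleanAlgebra
  have hmul : ∀ a b : A, BL.mul a b = a ⊓ b := h.mul_eq_inf
  have himp : ∀ a b : A, BL.imp a b = aᶜ ⊔ b := h.imp_eq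
  have key : ∀ x y : A, ¬ x ≤ y → ∃ f : A →[blLang] Bool, f x ≠ f y := by
    intro x y hxy
    -- As `x ≰ y`, a prime ideal contains `y` but not `x`; the indicator of its complement is the
    -- homomorphism.
    obtain ⟨J, hJ, hyJ, hdisj⟩ := DistribLattice.prime_ideal_of_disjoint_filter_ideal
      (F := Order.PFilter.principal x) (I := Order.Ideal.principal y) (by
        rw [Set.disjoint_left]
        exact fun z hz hz' => hxy (le_trans (Order.PFilter.mem_principal.1 hz)
          (Order.Ideal.mem_principal.1 hz')))
    have hx : x ∉ J := Set.disjoint_left.1 hdisj (Order.PFilter.mem_principal.2 le_rfl)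
    have hy : y ∈ J := hyJ (Order.Ideal.mem_principal.2 le_rfl)
    have hinf : ∀ p q : A, p ⊓ q ∈ J ↔ p ∈ J ∨ q ∈ J := fun p q =>
      ⟨hJ.mem_or_mem, fun hpq => hpq.elim (J.lower inf_le_left) (J.lower inf_le_right)⟩
    have hcompl : ∀ p : A, pᶜ ∈ J ↔ p ∉ J := fun p =>
      ⟨fun hp hp' => hJ.toIsProper.notMem_of_compl_mem hp hp',
        fun hp => hJ.mem_or_compl_mem.resolve_left hp⟩
    have htop : (⊤ : A) ∉ J := hJ.toIsProper.top_notMem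
    let f : A → Bool := fun z => decide (z ∉ J)
    have fmul : ∀ p q : A, f (BL.mul p q) = BL.mul (f p) (f q) := fun p q => by
      rw [hmul]
      show decide (p ⊓ q ∉ J) = (decide (p ∉ J) && decide (q ∉ J))
      simp [hinf]
    have fimp : ∀ p q : A, f (BL.imp p q) = BL.imp (f p) (f q) := fun p q => by
      rw [himp]
      show decide (pᶜ ⊔ q ∉ J) = (!decide (p ∉ J) || decide (q ∉ J))
      by_cases hp : p ∈ J <;> by_cases hq : q ∈ J <;> simp [Order.Ideal.sup_mem_iff, hcompl, hp, hq]
    have hBool := isBooleanBL_bool.isBLAlgebra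
    refine ⟨BL.homMk f (h.isBLAlgebra.map_sup hBool fmul fimp)
      (h.isBLAlgebra.map_inf hBool fmul fimp) fmul fimp ?_ ?_, ?_⟩
    · show decide ((⊥ : A) ∉ J) = false
      simp
    · show decide ((⊤ : A) ∉ J) = true
      simp [htop]
    · show decide (x ∉ J) ≠ decide (y ∉ J)
      simp [hx, hy]
  by_cases hle : a ≤ b
  · obtain ⟨f, hf⟩ := key b a fun hba => hab (le_antisymm hle hba)
    exact ⟨f, hf.symm⟩
  · exact key a b hle

/-- An element is determined by the set of two-valued assignments of the generators that extend to a
homomorphism making it true, and there are finitely many such sets. -/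
theorem finite_of_fg (h : IsBooleanBL A) (hfg : Structure.FG blLang A) : Finite A := by
  obtain ⟨S, hS, htop⟩ := Structure.fg_iff.1 hfg
  have := hS.to_subtype
  refine Finite.of_injective
    (fun a : A => {w : S → Bool | ∃ f : A →[blLang] Bool, (∀ s : S, f s = w s) ∧ f a = true}) ?_
  intro a b hab
  by_contra hne
  obtain ⟨f, hf⟩ := h.exists_hom_bool_ne hne
  have key : ∀ c : A, (fun s : S => f s) ∈ {w : S → Bool | ∃ f : A →[blLang] Bool,
      (∀ s : S, f s = w s) ∧ f c = true} ↔ f c = true := fun c => by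
    refine ⟨?_, fun hc => ⟨f, fun _ => rfl, hc⟩⟩
    rintro ⟨g, hg, hc⟩
    -- An assignment of the generators has at most one extension.
    obtain rfl : g = f := Hom.eq_of_eqOn_dense htop fun s hs => hg ⟨s, hs⟩
    exact hc
  exact hf (Bool.eq_iff_iff.2 ((key a).symm.trans ((Set.ext_iff.1 hab _).trans (key b))))

end IsBooleanBL

/-! ### Equational presentation of Boolean algebras -/

namespace BL

/-- The term obtained by applying a binary operation symbol. -/
def binTerm (f : BLFunc 2) (s t : blLang.Term ℕ) : blLang.Term ℕ :=
  Term.func (L := blLang) f ![s, t]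

/-- The term given by a constant symbol. -/
def constTerm (f : BLFunc 0) : blLang.Term ℕ := Term.func (L := blLang) f ![]

theorem realize_binTerm {A : Type*} [blLang.Structure A] (f : BLFunc 2) (s t : blLang.Term ℕ)
    (v : ℕ → A) : (binTerm f s t).realize v =
      Structure.funMap (L := blLang) (M := A) f ![s.realize v, t.realize v] := by
  refine congrArg _ (funext fun i => ?_)
  fin_cases i <;> rfl

theorem realize_constTerm {A : Type*} [blLang.Structure A] (f : BLFunc 0) (v : ℕ → A) :
    (constTerm f).realize v = Structure.funMap (L := blLang) (M := A) f ![] :=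
  congrArg (Structure.funMap (L := blLang) (M := A) f) (Subsingleton.elim _ _)

end BL

open BL in
/-- The variety of Boolean algebras in the language of BL-algebras. -/
def booleanVariety : AlgVariety blLang where
  identities :=
    let x := Term.var 0
    let y := Term.var 1
    let z := Term.var 2
    let sup := binTerm BLFunc.sup
    let inf := binTerm BLFunc.inf
    let imp := binTerm BLFunc.imp
    let zero := constTerm BLFunc.zero
    let one := constTerm BLFunc.one
    {(sup x y, sup y x), (sup (sup x y) z, sup x (sup y z)),
      (inf x y, inf y x), (inf (inf x y) z, inf x (inf y z)),
      (sup x (inf x y), x), (inf x (sup x y), x),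
      (inf x (sup y z), sup (inf x y) (inf x z)),
      (inf zero x, zero), (inf x one, x),
      (inf x (imp x zero), zero), (sup x (imp x zero), one),
      (binTerm BLFunc.mul x y, inf x y), (imp x y, sup (imp x zero) y)}

theorem mem_booleanVariety_iff (A : Type*) [blLang.Structure A] :
    booleanVariety.Mem A ↔ IsBooleanBL A := by
  have hv : ∀ (a b c : A), ∃ v : ℕ → A, v 0 = a ∧ v 1 = b ∧ v 2 = c := fun a b c =>
    ⟨fun n => if n = 0 then a else if n = 1 then b else c, by simp⟩
  simp only [AlgVariety.Mem, booleanVariety, Set.mem_insert_iff, Set.mem_singleton_iff,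
    forall_eq_or_imp, forall_eq, BL.realize_binTerm, BL.realize_constTerm, Term.realize_var]
  constructor
  · rintro ⟨h1, h2, h3, h4, h5, h6, h7, h8, h9, h10, h11, h12, h13⟩
    constructor
    · intro a b
      obtain ⟨v, rfl, rfl, -⟩ := hv a b a
      exact h1 v
    · intro a b c
      obtain ⟨v, rfl, rfl, rfl⟩ := hv a b c
      exact h2 v
    · intro a b
      obtain ⟨v, rfl, rfl, -⟩ := hv a b a
      exact h3 v
    · intro a b c
      obtain ⟨v, rfl, rfl, rfl⟩ := hv a b c
      exact h4 v
    · intro a b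
      obtain ⟨v, rfl, rfl, -⟩ := hv a b a
      exact h5 v
    · intro a b
      obtain ⟨v, rfl, rfl, -⟩ := hv a b a
      exact h6 v
    · intro a b c
      obtain ⟨v, rfl, rfl, rfl⟩ := hv a b c
      exact h7 v
    · exact fun a => h8 fun _ => a
    · exact fun a => h9 fun _ => a
    · exact fun a => h10 fun _ => a
    · exact fun a => h11 fun _ => a
    · intro a b
      obtain ⟨v, rfl, rfl, -⟩ := hv a b a
      exact h12 v
    · intro a b
      obtain ⟨v, rfl, rfl, -⟩ := hv a b a
      exact h13 v
  · intro h
    exact ⟨fun v => h.sup_comm _ _, fun v => h.sup_assoc _ _ _, fun v => h.inf_comm _ _,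
      fun v => h.inf_assoc _ _ _, fun v => h.sup_inf_self _ _, fun v => h.inf_sup_self _ _,
      fun v => h.inf_sup_distrib _ _ _, fun v => h.zero_le _, fun v => h.le_one _,
      fun v => h.inf_neg _, fun v => h.sup_neg _, fun v => h.mul_eq_inf _ _,
      fun v => h.imp_eq _ _⟩

theorem finiteSIMapOnto_of_stonean {V : AlgVariety blLang}
    (hV : ∀ (A : Type u) [blLang.Structure A], V.Mem A → IsStoneanBL A) :
    FiniteSIMapOnto.{u} V Bool :=
  fun A _ hA _ hsi => (hV A hA).exists_hom_bool hsi isBooleanBL_bool.isBLAlgebra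

theorem mainTheorem10 :
    -- locally finite varieties of bounded hoops
    (∀ V : AlgVariety hoopLang,
      (∀ (A : Type u) [hoopLang.Structure A], V.Mem A → IsBoundedHoop A) →
      AlgVariety.LocallyFinite.{u} V → FiniteSIMapOnto.{u} V Bool →
      FinitelyPresentedProjective.{u} V) ∧
    -- locally finite varieties of BL-algebras
    (∀ V : AlgVariety blLang,
      (∀ (A : Type u) [blLang.Structure A], V.Mem A → IsBLAlgebra A) →
      AlgVariety.LocallyFinite.{u} V → FiniteSIMapOnto.{u} V Bool →
      FinitelyPresentedProjective.{u} V) ∧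
    -- Boolean algebras form a variety of BL-algebras to which the theorem applies
    (∃ V : AlgVariety blLang,
      (∀ (A : Type u) [blLang.Structure A], V.Mem A ↔ IsBooleanBL A) ∧
      (∀ (A : Type u) [blLang.Structure A], V.Mem A → IsBLAlgebra A) ∧
      AlgVariety.LocallyFinite.{u} V ∧ FiniteSIMapOnto.{u} V Bool ∧
      FinitelyPresentedProjective.{u} V) ∧
    -- the theorem applies to locally finite varieties of Stonean BL-algebras
    (∀ V : AlgVariety blLang,
      (∀ (A : Type u) [blLang.Structure A], V.Mem A → IsStoneanBL A) →
      AlgVariety.LocallyFinite.{u} V →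
      FiniteSIMapOnto.{u} V Bool ∧ FinitelyPresentedProjective.{u} V) := by

  have hBool : ∀ (A : Type u) [blLang.Structure A], booleanVariety.Mem A → IsBooleanBL A :=
    fun A _ => (mem_booleanVariety_iff A).1
  have hlf : AlgVariety.LocallyFinite.{u} booleanVariety :=
    fun A _ hA hfg => (hBool A hA).finite_of_fg hfg
  have hsi : FiniteSIMapOnto.{u} booleanVariety Bool :=
    finiteSIMapOnto_of_stonean fun A _ hA => (hBool A hA).isStoneanBL
  refine ⟨fun V => V.finitelyPresentedProjective_hoop, fun V => V.finitelyPresentedProjective_bl,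
    ⟨booleanVariety, fun A _ => mem_booleanVariety_iff A, fun A _ hA => (hBool A hA).isBLAlgebra,
      hlf, hsi, ?_⟩, fun V hV hlf => ?_⟩
  · exact booleanVariety.finitelyPresentedProjective_bl (fun A _ hA => (hBool A hA).isBLAlgebra)
      hlf hsi
  · have hsi := finiteSIMapOnto_of_stonean hV
    exact ⟨hsi, V.finitelyPresentedProjective_bl (fun A _ hA => (hV A hA).toIsBLAlgebra) hlf hsi⟩
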